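/- All hypergraphs $\mathcal H=(V,\mathcal E)$ are finite and have no multiple hyperedges. A hypergraph is $k$-uniform if every hyperedge has exactly $k$ vertices. The edge intersection hypergraph $EI(\mathcal H)$ of $\mathcal H=(V,\mathcal E)$ has vertex set $V$ and hyperedge set $$\{e_1\cap e_2 \mid e_1,e_2\in\mathcal E,\ e_1\ne e_2,\ |e_1\cap e_2|\ge 2\}.$$ Let $C_n$ be the cycle with vertex set $V=\{1,\dots,n\}$ and edges $\{i,i+1\}$, $i\in V$ (indices modulo $n$), regarded as a 2-uniform hypergraph, and let $\mu^k_n$ denote the minimum number of hyperedges of a $k$-uniform hypergraph $\mathcal H$ with $EI(\mathcal H)=C_n$. Let $n\ge 24$. Then there exists a 6-uniform hypergraph $\mathcal H=(V,\mathcal E)$ with $EI(\mathcal H)=C_n$ and $|\mathcal E|=\lceil n/2\rceil$. Moreover, $\mu^6_n=\lceil n/2\rceil$. -/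

import Mathlib

namespace Hypergraph

variable {α : Type*}

/-- A hypergraph is `k`-uniform if all its hyperedges have exactly `k` elements. -/
def IsUniform (H : Hypergraph α) (k : ℕ) : Prop :=
  ∀ e ∈ H.edgeSet, e.encard = k

/-- The edge intersection hypergraph `EI(H)`: it has the vertex set of `H`, and its hyperedges are
the intersections with at least two elements of two distinct hyperedges of `H`. -/
def edgeIntersection (H : Hypergraph α) : Hypergraph α where
  vertexSet := H.vertexSet
  edgeSet := {e | ∃ e₁ ∈ H.edgeSet, ∃ e₂ ∈ H.edgeSet,
    e₁ ≠ e₂ ∧ 2 ≤ (e₁ ∩ e₂).encard ∧ e = e₁ ∩ e₂}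
  subset_vertexSet_of_mem_edgeSet' := by
    rintro e ⟨e₁, h₁, e₂, -, -, -, rfl⟩
    exact Set.inter_subset_left.trans (H.subset_vertexSet_of_mem_edgeSet' h₁)

/-- A simple graph, regarded as a 2-uniform hypergraph on all the vertices of the graph. -/
def ofSimpleGraph (G : SimpleGraph α) : Hypergraph α where
  vertexSet := Set.univ
  edgeSet := {e | ∃ u v, G.Adj u v ∧ e = {u, v}}
  subset_vertexSet_of_mem_edgeSet' := fun _ _ => Set.subset_univ _

/-- The cycle `C_n` on the vertex set `Fin n`, as a hypergraph. -/
def cycle (n : ℕ) : Hypergraph (Fin n) :=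
  ofSimpleGraph (SimpleGraph.cycleGraph n)

/-- The minimum number of hyperedges of a `k`-uniform hypergraph `H` with `EI(H) = C_n`
(with value `0` if there is no such hypergraph). -/
noncomputable def mu (k n : ℕ) : ℕ :=
  sInf {m | ∃ H : Hypergraph (Fin n),
    H.IsUniform k ∧ H.edgeIntersection = cycle n ∧ H.edgeSet.ncard = m}

end Hypergraph

/-!
The two edges of `C_n` at a vertex force at least three hyperedges through it, so double counting
incidences gives `3 * n ≤ 6 * |ℰ|`. Equality up to rounding is attained as follows.

For `n = 2 * m`, take the translates of `{0, 1, 2, 3, 7, 8}` by the even residues modulo `n`. Two of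
them differ by an even shift, and a nonzero even shift maps at most two offsets to offsets, which
are then consecutive. Each pair of consecutive residues does arise: the shift `2` maps `{0, 1}` to
`{2, 3}`, and the shift `6` maps `{1, 2}` to `{7, 8}`.

For `n = 2 * m - 1`, the set `{0, 1, 2, 3, 11, 12}` does the same modulo `n + 1`. Deleting the
residue `-1` affects only three hyperedges; each of them gets a new sixth vertex, chosen so that
`-2` and `0` become adjacent and no other pair appears.
-/

namespace EdgeIntersection

open Hypergraph Finset

section TriangleFree

variable {α ι : Type*} {G : SimpleGraph α}

theorem eq_pair_of_isClique (hG : G.CliqueFree 3) {s : Set α} (hs : G.IsClique s) {x y : α}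
    (hx : x ∈ s) (hy : y ∈ s) (hxy : x ≠ y) : s = {x, y} := by
  classical
  refine subset_antisymm (fun z hz => ?_) (Set.pair_subset hx hy)
  by_contra! hne
  simp only [Set.mem_insert_iff, Set.mem_singleton_iff, not_or] at hne
  exact hG {x, y, z} (SimpleGraph.is3Clique_triple_iff.2
    ⟨hs hx hy hxy, hs hx hz (Ne.symm hne.1), hs hy hz (Ne.symm hne.2)⟩)

theorem encard_le_two_of_isClique (hG : G.CliqueFree 3) {s : Set α} (hs : G.IsClique s) :
    s.encard ≤ 2 := by
  by_contra! h
  obtain ⟨x, y, hx, hy, hxy⟩ := Set.one_lt_encard_iff.1 (lt_trans (by norm_num) h)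
  rw [eq_pair_of_isClique hG hs hx hy hxy, Set.encard_pair hxy] at h
  exact h.false

/-- The hypergraph on all points of `α` whose hyperedges are the members of the family `F`. -/
def ofFamily (F : ι → Set α) : Hypergraph α where
  vertexSet := Set.univ
  edgeSet := Set.range F
  subset_vertexSet_of_mem_edgeSet' _ _ := Set.subset_univ _

variable {F : ι → Set α}

theorem injective_of_pairwise_isClique (hG : G.CliqueFree 3) (hF : ∀ i, 2 < (F i).encard)
    (hclique : Pairwise fun i j => G.IsClique (F i ∩ F j)) : Function.Injective F := by
  intro i j hij
  by_contra hne
  have h := encard_le_two_of_isClique hG (hclique hne)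
  rw [← hij, Set.inter_self] at h
  exact h.not_gt (hF i)

theorem edgeIntersection_ofFamily (hG : G.CliqueFree 3) (hF : ∀ i, 2 < (F i).encard)
    (hclique : Pairwise fun i j => G.IsClique (F i ∩ F j))
    (hcover : ∀ x y, G.Adj x y → ∃ i j, i ≠ j ∧ x ∈ F i ∩ F j ∧ y ∈ F i ∩ F j) :
    (ofFamily F).edgeIntersection = ofSimpleGraph G := by
  refine Hypergraph.ext rfl (Set.ext fun e => ⟨?_, ?_⟩)
  · rintro ⟨_, ⟨i, rfl⟩, _, ⟨j, rfl⟩, hne, hcard, rfl⟩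
    have hij := hclique (ne_of_apply_ne F hne)
    obtain ⟨x, y, hx, hy, hxy⟩ := Set.one_lt_encard_iff.1 (lt_of_lt_of_le (by norm_num) hcard)
    exact ⟨x, y, hij hx hy hxy, eq_pair_of_isClique hG hij hx hy hxy⟩
  · rintro ⟨x, y, hadj, rfl⟩
    obtain ⟨i, j, hij, hx, hy⟩ := hcover x y hadj
    have hinter := eq_pair_of_isClique hG (hclique hij) hx hy hadj.ne
    refine ⟨_, ⟨i, rfl⟩, _, ⟨j, rfl⟩, ?_, ?_, hinter.symm⟩
    · exact (injective_of_pairwise_isClique hG hF hclique).ne hij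
    · rw [hinter, Set.encard_pair hadj.ne]

end TriangleFree

section LowerBound

variable {α : Type*} {G : SimpleGraph α} {H : Hypergraph α}

-- If only two hyperedges contained `v`, all the edges `{v, u}` of `G` would equal their
-- intersection.
theorem two_lt_encard_star (hH : H.edgeIntersection = ofSimpleGraph G) {v : α}
    (hv : (G.neighborSet v).Nontrivial) : 2 < {e ∈ H.edgeSet | v ∈ e}.encard := by
  set S := {e ∈ H.edgeSet | v ∈ e}
  by_contra! hS
  have edge_eq : ∀ u, G.Adj v u → ({v, u} : Set α) = ⋂₀ S := by
    intro u hu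
    have hmem : {v, u} ∈ H.edgeIntersection.edgeSet := hH ▸ ⟨v, u, hu, rfl⟩
    obtain ⟨e₁, h₁, e₂, h₂, hne, -, hvu⟩ := hmem
    have hv' : v ∈ e₁ ∩ e₂ := hvu ▸ Set.mem_insert v {u}
    have hpair : {e₁, e₂} = S :=
      (Set.finite_of_encard_le_coe hS).eq_of_subset_of_encard_le'
        (Set.pair_subset ⟨h₁, hv'.1⟩ ⟨h₂, hv'.2⟩) (by rwa [Set.encard_pair hne])
    rw [hvu, ← hpair, Set.sInter_pair]
  obtain ⟨u, hu, w, hw, huw⟩ := hv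
  have hmem : u ∈ ({v, w} : Set α) := by
    rw [edge_eq w hw, ← edge_eq u hu]
    exact Set.mem_insert_of_mem v rfl
  exact hmem.elim hu.ne' huw

theorem three_mul_card_le_mul_ncard_edgeSet [Fintype α] {k : ℕ} (hk : H.IsUniform k)
    (hH : H.edgeIntersection = ofSimpleGraph G) (hG : ∀ v, (G.neighborSet v).Nontrivial) :
    3 * Fintype.card α ≤ k * H.edgeSet.ncard := by
  classical
  rw [mul_comm, mul_comm k, Set.ncard_eq_toFinset_card', ← card_univ]
  refine card_mul_le_card_mul (fun (v : α) (e : Set α) => v ∈ e) (fun v _ => ?_) fun e he => ?_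
  · have h := two_lt_encard_star hH (hG v)
    have hstar : {e ∈ H.edgeSet | v ∈ e} =
        H.edgeSet.toFinset.bipartiteAbove (fun (v : α) (e : Set α) => v ∈ e) v := by
      ext e
      simp [bipartiteAbove]
    rw [hstar, Set.encard_coe_eq_coe_finsetCard] at h
    exact_mod_cast h
  · have h := hk e (Set.mem_toFinset.1 he)
    have hpoints : e = (univ : Finset α).bipartiteBelow (fun (v : α) (e : Set α) => v ∈ e) e := by
      ext v
      simp [bipartiteBelow]
    rw [hpoints, Set.encard_coe_eq_coe_finsetCard] at h
    exact_mod_cast h.le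

end LowerBound

section CycleGraph

/-- The vertex `v` comes right after `u` in the cyclic order on `Fin n`. -/
def Next {n : ℕ} (u v : Fin n) : Prop :=
  (v : ℕ) = u + 1 ∨ (u : ℕ) + 1 = n ∧ (v : ℕ) = 0

variable {n : ℕ}

theorem cycleGraph_adj_iff_next (hn : 2 ≤ n) {u v : Fin n} :
    (SimpleGraph.cycleGraph n).Adj u v ↔ Next u v ∨ Next v u := by
  have val_sub_eq_one (a b : Fin n) : (a - b).val = 1 ↔ Next b a := by
    unfold Next
    rcases le_or_gt b a with h | h
    · have := Fin.coe_sub_iff_le.2 h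
      lia
    · have := Fin.coe_sub_iff_lt.2 h
      lia
  rw [SimpleGraph.cycleGraph_adj', val_sub_eq_one, val_sub_eq_one, or_comm]

theorem cliqueFree_three_cycleGraph (hn : 4 ≤ n) : (SimpleGraph.cycleGraph n).CliqueFree 3 := by
  intro s hs
  obtain ⟨x, y, z, hxy, hxz, hyz, -⟩ := SimpleGraph.is3Clique_iff.1 hs
  rw [cycleGraph_adj_iff_next (by lia)] at hxy hxz hyz
  unfold Next at hxy hxz hyz
  lia

theorem nontrivial_neighborSet_cycleGraph (hn : 3 ≤ n) (v : Fin n) :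
    ((SimpleGraph.cycleGraph n).neighborSet v).Nontrivial := by
  obtain ⟨n, rfl⟩ := Nat.exists_eq_add_of_le' hn
  have h : 1 < ((SimpleGraph.cycleGraph (n + 3)).neighborFinset v).card := by
    rw [SimpleGraph.card_neighborFinset_eq_degree, SimpleGraph.cycleGraph_degree_three_le]
    exact one_lt_two
  rw [← SimpleGraph.coe_neighborFinset]
  exact one_lt_card_iff_nontrivial.1 h

end CycleGraph

section Translates

variable {m : ℕ}

theorem even_intCast_iff {d : ℤ} : Even (d : ZMod (2 * m)) ↔ Even d := by
  refine ⟨fun h => ?_, fun h => h.map (Int.castRingHom _)⟩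
  have h₂ : Even (d : ZMod 2) := by
    simpa using h.map (ZMod.castHom (dvd_mul_right 2 m) (ZMod 2))
  obtain ⟨c, hc⟩ := h₂
  rw [CharTwo.add_self_eq_zero, ZMod.intCast_zmod_eq_zero_iff_dvd] at hc
  exact even_iff_two_dvd.2 hc

theorem even_or_even_sub_one (z : ZMod (2 * m)) : Even z ∨ Even (z - 1) := by
  obtain ⟨a, rfl⟩ := ZMod.intCast_surjective z
  rw [even_intCast_iff, ← Int.cast_one, ← Int.cast_sub, even_intCast_iff]
  grind

theorem card_even (hm : m ≠ 0) : Nat.card {s : ZMod (2 * m) // Even s} = m := by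
  have heven (s : ZMod (2 * m)) : Even s ↔ s ∈ AddSubgroup.zmultiples ((2 : ℕ) : ZMod (2 * m)) := by
    rw [even_iff_exists_two_mul, AddSubgroup.mem_zmultiples_iff, ZMod.intCast_surjective.exists]
    simp only [zsmul_eq_mul, Nat.cast_ofNat, mul_comm, eq_comm]
  simp only [heven]
  rw [Nat.card_zmultiples, ZMod.addOrderOf_coe 2 (by lia), Nat.gcd_mul_right_left,
    Nat.mul_div_cancel_left m two_pos]

/-- The subset `s + B` of `ZMod N`, for a set `B` of integer offsets. -/
def translate {N : ℕ} (s : ZMod N) (B : Finset ℤ) : Set (ZMod N) :=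
  (fun d : ℤ => s + d) '' B

theorem intCast_inj_of_abs_sub_lt {N : ℕ} {a b : ℤ} (h : |a - b| < N) :
    (a : ZMod N) = b ↔ a = b := by
  refine ⟨fun hab => ?_, fun hab => hab ▸ rfl⟩
  rw [← sub_eq_zero, ← Int.cast_sub, ZMod.intCast_zmod_eq_zero_iff_dvd] at hab
  exact sub_eq_zero.1 (Int.eq_zero_of_abs_lt_dvd hab h)

variable {B C : Finset ℤ} {r : ℕ}

theorem encard_translate {N : ℕ} (s : ZMod N) (hB : B ⊆ Icc 0 (r : ℤ)) (hr : r < N) :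
    (translate s B).encard = #B := by
  rw [translate, Set.InjOn.encard_image, Set.encard_coe_eq_coe_finsetCard]
  intro d hd e he hde
  have hd := mem_Icc.1 (hB hd)
  have he := mem_Icc.1 (hB he)
  exact (intCast_inj_of_abs_sub_lt (by grind)).1 (add_left_cancel hde)

theorem exists_offsets_of_mem_inter_translate (hB : B ⊆ Icc 0 (r : ℤ)) (hC : C ⊆ Icc 0 (r : ℤ))
    (hr : r < m) {s t x y : ZMod (2 * m)} (hs : Even s) (ht : Even t) (hst : s ≠ t)
    (hx : x ∈ translate s B ∩ translate t C) (hy : y ∈ translate s B ∩ translate t C) :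
    ∃ d ∈ B, ∃ e ∈ B, ∃ d' ∈ C, e - d + d' ∈ C ∧ d ≠ d' ∧ Even (d - d') ∧
      x = s + d ∧ y = s + e ∧ x = t + d' := by
  obtain ⟨⟨d, hd, rfl⟩, d', hd', (hxt : t + (d' : ZMod (2 * m)) = s + d)⟩ := hx
  obtain ⟨⟨e, he, rfl⟩, e', he', (hyt : t + (e' : ZMod (2 * m)) = s + e)⟩ := hy
  have hdiff : e' = e - d + d' := by
    refine (intCast_inj_of_abs_sub_lt (N := 2 * m) ?_).1 ?_
    · have := mem_Icc.1 (hB hd)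
      have := mem_Icc.1 (hB he)
      have := mem_Icc.1 (hC hd')
      have := mem_Icc.1 (hC he')
      grind
    · push_cast
      linear_combination hyt - hxt
  refine ⟨d, hd, e, he, d', hd', hdiff ▸ he', ?_, ?_, rfl, rfl, hxt.symm⟩
  · rintro rfl
    exact hst (add_right_cancel hxt).symm
  · rw [← even_intCast_iff (m := m), Int.cast_sub, show (d : ZMod (2 * m)) - d' = t - s by
      linear_combination - hxt]
    exact ht.sub hs

/-- A nonzero even shift never maps two elements of `B` into `B`, unless these are consecutive. -/
def ConsecutiveEvenShifts (B : Finset ℤ) : Prop :=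
  ∀ d ∈ B, ∀ e ∈ B, ∀ d' ∈ B, e - d + d' ∈ B → d ≠ d' → Even (d - d') →
    e = d ∨ e = d + 1 ∨ d = e + 1

theorem ConsecutiveEvenShifts.eq_or_consecutive (h : ConsecutiveEvenShifts B)
    (hB : B ⊆ Icc 0 (r : ℤ)) (hr : r < m) {s t x y : ZMod (2 * m)} (hs : Even s) (ht : Even t)
    (hst : s ≠ t) (hx : x ∈ translate s B ∩ translate t B)
    (hy : y ∈ translate s B ∩ translate t B) : x = y ∨ y = x + 1 ∨ x = y + 1 := by
  obtain ⟨d, hd, e, he, d', hd', hed, hne, heven, rfl, rfl, -⟩ :=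
    exists_offsets_of_mem_inter_translate hB hB hr hs ht hst hx hy
  rcases h d hd e he d' hd' hed hne heven with rfl | rfl | rfl
  · exact Or.inl rfl
  · exact Or.inr (Or.inl (by push_cast; ring))
  · exact Or.inr (Or.inr (by push_cast; ring))

/-- The vertices `x` and `y` both lie in two of the translates `s + S s` with `s` even. -/
def Covers (S : ZMod (2 * m) → Finset ℤ) (x y : ZMod (2 * m)) : Prop :=
  ∃ s t, Even s ∧ Even t ∧ s ≠ t ∧
    x ∈ translate s (S s) ∩ translate t (S t) ∧ y ∈ translate s (S s) ∩ translate t (S t)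

theorem covers_add_intCast {S : ZMod (2 * m) → Finset ℤ} {z : ZMod (2 * m)} {a b c : ℤ}
    (hab : a ≠ b) (hlt : |a - b| < (2 * m : ℕ)) (heven : Even (a - b)) (hz : Even (z - a))
    (ha : a ∈ S (z - a)) (hac : a + c ∈ S (z - a)) (hb : b ∈ S (z - b)) (hbc : b + c ∈ S (z - b)) :
    Covers S z (z + c) := by
  refine ⟨z - a, z - b, hz, ?_, ?_, ⟨⟨a, ha, ?_⟩, b, hb, ?_⟩, ⟨a + c, hac, ?_⟩, b + c, hbc, ?_⟩
  · rw [← sub_add_sub_cancel z (a : ZMod (2 * m)) b, ← Int.cast_sub]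
    exact hz.add (even_intCast_iff.2 heven)
  · exact fun h => hab ((intCast_inj_of_abs_sub_lt hlt).1 (sub_right_injective h))
  all_goals
    push_cast
    ring

end Translates

section Assembly

variable {n m : ℕ}

/-- The embedding of the vertices of `C_n` as consecutive residues modulo `N`, starting at `0`;
it is injective for `n ≤ N`. -/
def toResidue (N : ℕ) (u : Fin n) : ZMod N := (u : ℕ)

theorem toResidue_injective {N : ℕ} (hN : n ≤ N) :
    Function.Injective (toResidue N : Fin n → ZMod N) := by
  intro u v huv
  have h := (ZMod.natCast_eq_natCast_iff' _ _ _).1 huv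
  rw [Nat.mod_eq_of_lt (by lia), Nat.mod_eq_of_lt (by lia)] at h
  exact Fin.ext h

theorem mem_range_toResidue {N : ℕ} [NeZero N] {z : ZMod N} (hz : z.val < n) :
    z ∈ Set.range (toResidue N : Fin n → ZMod N) :=
  ⟨⟨z.val, hz⟩, ZMod.natCast_zmod_val z⟩

theorem exists_edgeIntersection_eq_cycle {k r : ℕ} (hn : 4 ≤ n) (hnm : n ≤ 2 * m) (hk : 2 < k)
    (hr : r < 2 * m) (S : ZMod (2 * m) → Finset ℤ) (hS : ∀ s, S s ⊆ Icc 0 (r : ℤ))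
    (hcard : ∀ s, #(S s) = k)
    (hrange : ∀ s, Even s →
      translate s (S s) ⊆ Set.range (toResidue (2 * m) : Fin n → ZMod (2 * m)))
    (hclique : ∀ s t, Even s → Even t → s ≠ t → ∀ u v : Fin n,
      toResidue (2 * m) u ∈ translate s (S s) ∩ translate t (S t) →
      toResidue (2 * m) v ∈ translate s (S s) ∩ translate t (S t) →
      u ≠ v → Next u v ∨ Next v u)
    (hcover : ∀ u v : Fin n, Next u v → Covers S (toResidue (2 * m) u) (toResidue (2 * m) v)) :
    ∃ H : Hypergraph (Fin n), H.IsUniform k ∧ H.edgeIntersection = cycle n ∧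
      H.edgeSet.ncard = m := by
  let F : {s : ZMod (2 * m) // Even s} → Set (Fin n) :=
    fun s => toResidue (2 * m) ⁻¹' translate s.1 (S s)
  have hF : ∀ s, (F s).encard = k := by
    intro s
    rw [Set.encard_preimage_of_injective_subset_range (toResidue_injective hnm) (hrange s s.2),
      encard_translate _ (hS _) hr, hcard]
  have hF₂ : ∀ s, 2 < (F s).encard := fun s => by rw [hF]; exact_mod_cast hk
  have hfree := cliqueFree_three_cycleGraph hn
  have hpair : Pairwise fun s t => (SimpleGraph.cycleGraph n).IsClique (F s ∩ F t) :=
    fun s t hst u hu v hv huv => (cycleGraph_adj_iff_next (by lia)).2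
      (hclique s t s.2 t.2 (Subtype.coe_ne_coe.2 hst) u v hu hv huv)
  refine ⟨ofFamily F, ?_, edgeIntersection_ofFamily hfree hF₂ hpair fun u v huv => ?_, ?_⟩
  · rintro _ ⟨s, rfl⟩
    exact hF s
  · rcases (cycleGraph_adj_iff_next (by lia)).1 huv with h | h
    · obtain ⟨s, t, hs, ht, hst, hu, hv⟩ := hcover u v h
      exact ⟨⟨s, hs⟩, ⟨t, ht⟩, Subtype.coe_ne_coe.1 hst, hu, hv⟩
    · obtain ⟨s, t, hs, ht, hst, hv, hu⟩ := hcover v u h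
      exact ⟨⟨s, hs⟩, ⟨t, ht⟩, Subtype.coe_ne_coe.1 hst, hu, hv⟩
  · change (Set.range F).ncard = m
    rw [Set.ncard_range_of_injective (injective_of_pairwise_isClique hfree hF₂ hpair),
      card_even (by lia)]

end Assembly

section EvenCycle

/-- The offsets of the hyperedges in the construction for even `n`: they are `s + evenShape`, for
the even residues `s` modulo `n`. -/
def evenShape : Finset ℤ := {0, 1, 2, 3, 7, 8}

theorem consecutiveEvenShifts_evenShape : ConsecutiveEvenShifts evenShape := by
  unfold ConsecutiveEvenShifts
  decide

variable {m : ℕ}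

theorem next_iff_toResidue_eq_add_one {u v : Fin (2 * m)} :
    Next u v ↔ toResidue (2 * m) v = toResidue (2 * m) u + 1 := by
  have h := ZMod.natCast_eq_natCast_iff' (v : ℕ) (u + 1) (2 * m)
  rw [Nat.mod_eq_of_lt v.isLt] at h
  rw [toResidue, toResidue, ← Nat.cast_succ, h, Next]
  rcases Nat.lt_or_ge (u + 1) (2 * m) with hu | hu
  · rw [Nat.mod_eq_of_lt hu]
    lia
  · have hu : (u : ℕ) + 1 = 2 * m := by lia
    rw [hu, Nat.mod_self]
    lia

theorem exists_edgeIntersection_eq_cycle_of_even (hm : 9 ≤ m) :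
    ∃ H : Hypergraph (Fin (2 * m)), H.IsUniform 6 ∧ H.edgeIntersection = cycle (2 * m) ∧
      H.edgeSet.ncard = m := by
  have hshape : evenShape ⊆ Icc 0 ((8 : ℕ) : ℤ) := by decide
  refine exists_edgeIntersection_eq_cycle (by lia) le_rfl (by lia) (by lia) (fun _ => evenShape)
    (fun _ => hshape) (fun _ => rfl) ?_ ?_ ?_
  · have : NeZero (2 * m) := ⟨by lia⟩
    exact fun _ _ z _ => mem_range_toResidue z.val_lt
  · intro s t hs ht hst u v hu hv huv
    rw [next_iff_toResidue_eq_add_one, next_iff_toResidue_eq_add_one]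
    exact (consecutiveEvenShifts_evenShape.eq_or_consecutive hshape (by lia) hs ht hst hu
      hv).resolve_left ((toResidue_injective le_rfl).ne huv)
  · intro u v huv
    rw [next_iff_toResidue_eq_add_one] at huv
    rw [huv, ← Int.cast_one]
    rcases even_or_even_sub_one (toResidue (2 * m) u) with hz | hz
    · exact covers_add_intCast (S := fun _ => evenShape) (a := 0) (b := 2) (by decide)
        (by grind) (by decide) (by simpa using hz) (by decide) (by decide) (by decide) (by decide)
    · exact covers_add_intCast (S := fun _ => evenShape) (a := 1) (b := 7) (by decide)
        (by grind) (by decide) (by simpa using hz) (by decide) (by decide) (by decide) (by decide)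

end EvenCycle

section OddCycle

/-- The successor relation of the cyclic order on `ZMod N` with the residue `-1` removed, stated for
any ring so that it can be decided on integer representatives. -/
def SkipNext {R : Type*} [Ring R] (x y : R) : Prop :=
  y = x + 1 ∨ x = -2 ∧ y = 0

theorem SkipNext.intCast {R : Type*} [Ring R] {a b : ℤ} (h : SkipNext a b) :
    SkipNext (a : R) (b : R) := by
  rcases h with rfl | ⟨rfl, rfl⟩
  · exact Or.inl (by push_cast; rfl)
  · exact Or.inr (by simp)

/-- The offsets of all but three of the hyperedges in the construction for odd `n`: they are
`s + oddShape`, for the even residues `s` modulo `n + 1`. -/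
def oddShape : Finset ℤ := {0, 1, 2, 3, 11, 12}

/-- The three hyperedges `s + oddShape` that contain the residue `-1`, as pairs of `s` and the set
of offsets that replaces `oddShape`. -/
def repairedShapes : List (ℤ × Finset ℤ) :=
  [(-2, {0, 2, 3, 6, 11, 12}), (-4, {0, 1, 2, 4, 11, 12}), (-12, {0, 1, 2, 3, 6, 12})]

theorem consecutiveEvenShifts_oddShape : ConsecutiveEvenShifts oddShape := by
  unfold ConsecutiveEvenShifts
  decide

theorem eq_or_skipNext_of_repairedShapes_of_oddShape : ∀ p ∈ repairedShapes, ∀ d ∈ p.2, ∀ e ∈ p.2,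
    ∀ d' ∈ oddShape, e - d + d' ∈ oddShape → d ≠ d' → Even (d - d') →
      e = d ∨ SkipNext (p.1 + d) (p.1 + e) ∨ SkipNext (p.1 + e) (p.1 + d) := by
  unfold SkipNext
  decide

theorem eq_or_skipNext_of_repairedShapes : ∀ p ∈ repairedShapes, ∀ q ∈ repairedShapes, p ≠ q →
    ∀ d ∈ p.2, ∀ e ∈ p.2, ∀ d' ∈ q.2, e - d + d' ∈ q.2 → p.1 + d = q.1 + d' →
      e = d ∨ SkipNext (p.1 + d) (p.1 + e) ∨ SkipNext (p.1 + e) (p.1 + d) := by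
  unfold SkipNext
  decide

theorem subset_Icc_of_mem_repairedShapes :
    ∀ p ∈ repairedShapes, p.2 ⊆ Icc 0 ((12 : ℕ) : ℤ) := by
  decide

theorem card_of_mem_repairedShapes : ∀ p ∈ repairedShapes, #p.2 = 6 := by
  decide

theorem add_ne_neg_one_of_mem_repairedShapes :
    ∀ p ∈ repairedShapes, ∀ d ∈ p.2, p.1 + d ≠ -1 := by
  decide

theorem exists_repairedShapes_add_eq_neg_one :
    ∀ d ∈ oddShape, ¬ Even d → ∃ p ∈ repairedShapes, p.1 + d = -1 := by
  decide

theorem fst_mem_Icc_of_mem_repairedShapes :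
    ∀ p ∈ repairedShapes, p.1 ∈ Icc (-12 : ℤ) (-2) := by
  decide

theorem repairedShapes_eq_of_fst_eq :
    ∀ p ∈ repairedShapes, ∀ q ∈ repairedShapes, p.1 = q.1 → p = q := by
  decide

/-- The offsets of the hyperedge with base point `s` in the construction for odd `n`. -/
def oddShapeAt {N : ℕ} (s : ZMod N) : Finset ℤ :=
  (repairedShapes.find? fun p => (p.1 : ZMod N) = s).elim oddShape Prod.snd

theorem oddShapeAt_cases {N : ℕ} (s : ZMod N) :
    (oddShapeAt s = oddShape ∧ ∀ p ∈ repairedShapes, (p.1 : ZMod N) ≠ s) ∨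
      ∃ p ∈ repairedShapes, (p.1 : ZMod N) = s ∧ oddShapeAt s = p.2 := by
  unfold oddShapeAt
  rcases h : repairedShapes.find? fun p => (p.1 : ZMod N) = s with - | p
  · exact Or.inl ⟨by rw [h]; rfl, by simpa using h⟩
  · exact Or.inr ⟨p, List.mem_of_find?_eq_some h, by simpa using List.find?_some h,
      by rw [h]; rfl⟩

theorem oddShapeAt_subset_Icc {N : ℕ} (s : ZMod N) : oddShapeAt s ⊆ Icc 0 ((12 : ℕ) : ℤ) := by
  rcases oddShapeAt_cases s with ⟨h, -⟩ | ⟨p, hp, -, h⟩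
  · rw [h]
    decide
  · exact h ▸ subset_Icc_of_mem_repairedShapes p hp

theorem card_oddShapeAt {N : ℕ} (s : ZMod N) : #(oddShapeAt s) = 6 := by
  rcases oddShapeAt_cases s with ⟨h, -⟩ | ⟨p, hp, -, h⟩
  · rw [h]
    rfl
  · exact h ▸ card_of_mem_repairedShapes p hp

theorem mem_oddShapeAt_of_ne {N : ℕ} {s : ZMod N} {σ d : ℤ} (hd : d ∈ oddShape)
    (hσ : ∀ p ∈ repairedShapes, d ∈ p.2 ∨ p.1 = σ) (hs : s ≠ σ) : d ∈ oddShapeAt s := by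
  rcases oddShapeAt_cases s with ⟨h, -⟩ | ⟨p, hp, rfl, h⟩
  · exact h ▸ hd
  · exact h ▸ (hσ p hp).resolve_right fun hpσ => hs (congrArg _ hpσ)

theorem oddShapeAt_of_mem_repairedShapes {N : ℕ} (hN : 10 < N) {p : ℤ × Finset ℤ}
    (hp : p ∈ repairedShapes) : oddShapeAt (p.1 : ZMod N) = p.2 := by
  rcases oddShapeAt_cases (p.1 : ZMod N) with ⟨-, h⟩ | ⟨q, hq, hqp, h⟩
  · exact absurd rfl (h p hp)
  · have hp₁ := mem_Icc.1 (fst_mem_Icc_of_mem_repairedShapes p hp)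
    have hq₁ := mem_Icc.1 (fst_mem_Icc_of_mem_repairedShapes q hq)
    have hfst := (intCast_inj_of_abs_sub_lt (by grind)).1 hqp
    rw [h, repairedShapes_eq_of_fst_eq q hq p hp hfst]

variable {m : ℕ}

theorem neg_one_notMem_translate_oddShapeAt (hm : 6 ≤ m) {s : ZMod (2 * m)} (hs : Even s) :
    -1 ∉ translate s (oddShapeAt s) := by
  rintro ⟨d, hd, (hsd : s + (d : ZMod (2 * m)) = -1)⟩
  rcases oddShapeAt_cases s with ⟨h, hne⟩ | ⟨p, hp, rfl, h⟩
  · have hodd : ¬ Even d := by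
      intro heven
      have h₁ : Even ((-1 : ℤ) : ZMod (2 * m)) := by
        rw [Int.cast_neg, Int.cast_one, ← hsd]
        exact hs.add (even_intCast_iff.2 heven)
      exact absurd (even_intCast_iff.1 h₁) (by decide)
    obtain ⟨p, hp, hpd⟩ := exists_repairedShapes_add_eq_neg_one d (h ▸ hd) hodd
    refine hne p hp (add_right_cancel (b := (d : ZMod (2 * m))) ?_)
    rw [hsd, ← Int.cast_add, hpd, Int.cast_neg, Int.cast_one]
  · rw [h] at hd
    have hp₁ := mem_Icc.1 (fst_mem_Icc_of_mem_repairedShapes p hp)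
    have hd₁ := mem_Icc.1 (subset_Icc_of_mem_repairedShapes p hp hd)
    refine add_ne_neg_one_of_mem_repairedShapes p hp d hd
      ((intCast_inj_of_abs_sub_lt (N := 2 * m) (by grind)).1 ?_)
    exact_mod_cast hsd

theorem eq_or_skipNext_intCast {N : ℕ} {σ d e : ℤ}
    (h : e = d ∨ SkipNext (σ + d) (σ + e) ∨ SkipNext (σ + e) (σ + d)) :
    ((σ : ZMod N) + d = σ + e) ∨ SkipNext ((σ : ZMod N) + d) (σ + e) ∨
      SkipNext ((σ : ZMod N) + e) (σ + d) := by
  simp only [← Int.cast_add]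
  exact h.imp (fun h => by rw [h]) (Or.imp SkipNext.intCast SkipNext.intCast)

theorem eq_or_skipNext_of_mem_inter_of_oddShape (hm : 13 ≤ m) {p : ℤ × Finset ℤ}
    (hp : p ∈ repairedShapes) {t x y : ZMod (2 * m)} (hs : Even (p.1 : ZMod (2 * m)))
    (ht : Even t) (hst : (p.1 : ZMod (2 * m)) ≠ t)
    (hx : x ∈ translate (p.1 : ZMod (2 * m)) p.2 ∩ translate t oddShape)
    (hy : y ∈ translate (p.1 : ZMod (2 * m)) p.2 ∩ translate t oddShape) :
    x = y ∨ SkipNext x y ∨ SkipNext y x := by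
  obtain ⟨d, hd, e, he, d', hd', hed, hne, heven, rfl, rfl, -⟩ :=
    exists_offsets_of_mem_inter_translate (subset_Icc_of_mem_repairedShapes p hp) (by decide)
      (by lia) hs ht hst hx hy
  exact eq_or_skipNext_intCast
    (eq_or_skipNext_of_repairedShapes_of_oddShape p hp d hd e he d' hd' hed hne heven)

theorem eq_or_skipNext_of_mem_inter (hm : 13 ≤ m) {s t x y : ZMod (2 * m)} (hs : Even s)
    (ht : Even t) (hst : s ≠ t) (hx : x ∈ translate s (oddShapeAt s) ∩ translate t (oddShapeAt t))
    (hy : y ∈ translate s (oddShapeAt s) ∩ translate t (oddShapeAt t)) :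
    x = y ∨ SkipNext x y ∨ SkipNext y x := by
  rcases oddShapeAt_cases s with ⟨h, -⟩ | ⟨p, hp, rfl, h⟩ <;>
    rcases oddShapeAt_cases t with ⟨h', -⟩ | ⟨q, hq, rfl, h'⟩ <;> rw [h, h'] at hx hy
  · exact (consecutiveEvenShifts_oddShape.eq_or_consecutive (r := 12) (by decide) (by lia) hs ht
      hst hx hy).imp_right (Or.imp Or.inl Or.inl)
  · rw [Set.inter_comm] at hx hy
    exact eq_or_skipNext_of_mem_inter_of_oddShape hm hq ht hs hst.symm hx hy
  · exact eq_or_skipNext_of_mem_inter_of_oddShape hm hp hs ht hst hx hy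
  · obtain ⟨d, hd, e, he, d', hd', hed, -, -, rfl, rfl, hx'⟩ :=
      exists_offsets_of_mem_inter_translate (subset_Icc_of_mem_repairedShapes p hp)
        (subset_Icc_of_mem_repairedShapes q hq) (by lia) hs ht hst hx hy
    have hpq : p ≠ q := fun hpq => hst (hpq ▸ rfl)
    refine eq_or_skipNext_intCast (eq_or_skipNext_of_repairedShapes p hp q hq hpq d hd e he d' hd'
      hed ((intCast_inj_of_abs_sub_lt (N := 2 * m) ?_).1 (mod_cast hx')))
    have := mem_Icc.1 (fst_mem_Icc_of_mem_repairedShapes p hp)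
    have := mem_Icc.1 (fst_mem_Icc_of_mem_repairedShapes q hq)
    have := mem_Icc.1 (subset_Icc_of_mem_repairedShapes p hp hd)
    have := mem_Icc.1 (subset_Icc_of_mem_repairedShapes q hq hd')
    grind

theorem covers_oddShapeAt_neg_two_zero (hm : 6 ≤ m) :
    Covers (oddShapeAt : ZMod (2 * m) → Finset ℤ) (-2) 0 := by
  have h₂ := oddShapeAt_of_mem_repairedShapes (N := 2 * m) (by lia)
    (p := (-2, {0, 2, 3, 6, 11, 12})) (by decide)
  have h₄ := oddShapeAt_of_mem_repairedShapes (N := 2 * m) (by lia)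
    (p := (-4, {0, 1, 2, 4, 11, 12})) (by decide)
  have h := covers_add_intCast (S := oddShapeAt) (z := ((-2 : ℤ) : ZMod (2 * m)))
    (a := 0) (b := 2) (c := 2) (by decide) (by grind) (by decide)
  simp only [← Int.cast_sub, ← Int.cast_add, even_intCast_iff, Int.reduceNeg, Int.reduceSub,
    Int.reduceAdd, h₂, h₄] at h
  simpa using h (by decide) (by decide) (by decide) (by decide) (by decide)

theorem covers_oddShapeAt_of_skipNext (hm : 6 ≤ m) {x y : ZMod (2 * m)} (hx : x ≠ -1)
    (hy : y ≠ -1) (hxy : SkipNext x y) : Covers oddShapeAt x y := by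
  rcases hxy with rfl | ⟨rfl, rfl⟩
  · have hx₂ : x ≠ -2 := by
      rintro rfl
      exact hy (by ring)
    rw [← Int.cast_one]
    rcases even_or_even_sub_one x with hz | hz
    · refine covers_add_intCast (a := 0) (b := 2) (by decide)
        (by grind) (by decide) (by simpa using hz) ?_ ?_ ?_ ?_
      · exact mem_oddShapeAt_of_ne (σ := -2) (by decide) (by decide) (by simpa using hx₂)
      · exact mem_oddShapeAt_of_ne (σ := -2) (by decide) (by decide) (by simpa using hx₂)
      · exact mem_oddShapeAt_of_ne (σ := -4) (by decide) (by decide) (by grind)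
      · exact mem_oddShapeAt_of_ne (σ := -4) (by decide) (by decide) (by grind)
    · refine covers_add_intCast (a := 1) (b := 11) (by decide)
        (by grind) (by decide) (by simpa using hz) ?_ ?_ ?_ ?_
      · exact mem_oddShapeAt_of_ne (σ := -2) (by decide) (by decide) (by grind)
      · exact mem_oddShapeAt_of_ne (σ := -2) (by decide) (by decide) (by grind)
      · exact mem_oddShapeAt_of_ne (σ := -12) (by decide) (by decide) (by grind)
      · exact mem_oddShapeAt_of_ne (σ := -12) (by decide) (by decide) (by grind)
  · exact covers_oddShapeAt_neg_two_zero hm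

variable {n : ℕ}

theorem toResidue_ne_neg_one (hn : n + 1 = 2 * m) (u : Fin n) : toResidue (2 * m) u ≠ -1 := by
  rw [Ne, eq_neg_iff_add_eq_zero, toResidue, ← Nat.cast_succ, ZMod.natCast_eq_zero_iff]
  exact Nat.not_dvd_of_pos_of_lt (by lia) (by lia)

theorem mem_range_toResidue_of_ne_neg_one (hn : n + 1 = 2 * m) {z : ZMod (2 * m)} (hz : z ≠ -1) :
    z ∈ Set.range (toResidue (2 * m) : Fin n → ZMod (2 * m)) := by
  have : NeZero (2 * m) := ⟨by lia⟩
  have hlt := z.val_lt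
  refine mem_range_toResidue (lt_of_le_of_ne (by lia) fun hval => hz ?_)
  rw [← ZMod.natCast_zmod_val z, hval, eq_neg_iff_add_eq_zero, ← Nat.cast_succ,
    Nat.succ_eq_add_one, hn, ZMod.natCast_self]

theorem next_iff_skipNext_toResidue (hn : n + 1 = 2 * m) {u v : Fin n} :
    Next u v ↔ SkipNext (toResidue (2 * m) u) (toResidue (2 * m) v) := by
  have hsucc : toResidue (2 * m) v = toResidue (2 * m) u + 1 ↔ (v : ℕ) = u + 1 := by
    rw [toResidue, toResidue, ← Nat.cast_succ, ZMod.natCast_eq_natCast_iff',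
      Nat.mod_eq_of_lt (by lia), Nat.mod_eq_of_lt (by lia)]
  have hlast : toResidue (2 * m) u = -2 ↔ (u : ℕ) + 1 = n := by
    rw [eq_neg_iff_add_eq_zero, toResidue, ← Nat.cast_two (R := ZMod (2 * m)),
      ← Nat.cast_add, ZMod.natCast_eq_zero_iff]
    refine ⟨fun h => ?_, fun h => ⟨1, by lia⟩⟩
    have := Nat.le_of_dvd (by lia) h
    lia
  have hzero : toResidue (2 * m) v = 0 ↔ (v : ℕ) = 0 := by
    rw [toResidue, ZMod.natCast_eq_zero_iff]
    exact ⟨fun h => Nat.eq_zero_of_dvd_of_lt h (by lia), fun h => h ▸ dvd_zero _⟩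
  rw [Next, SkipNext, hsucc, hlast, hzero]

theorem exists_edgeIntersection_eq_cycle_of_odd (hm : 13 ≤ m) (hn : n + 1 = 2 * m) :
    ∃ H : Hypergraph (Fin n), H.IsUniform 6 ∧ H.edgeIntersection = cycle n ∧
      H.edgeSet.ncard = m := by
  refine exists_edgeIntersection_eq_cycle (by lia) (by lia) (by lia) (by lia) oddShapeAt
    oddShapeAt_subset_Icc card_oddShapeAt ?_ ?_ ?_
  · intro s hs z hz
    refine mem_range_toResidue_of_ne_neg_one hn ?_
    rintro rfl
    exact neg_one_notMem_translate_oddShapeAt (by lia) hs hz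
  · intro s t hs ht hst u v hu hv huv
    rw [next_iff_skipNext_toResidue hn, next_iff_skipNext_toResidue hn]
    exact (eq_or_skipNext_of_mem_inter hm hs ht hst hu hv).resolve_left
      ((toResidue_injective (by lia)).ne huv)
  · intro u v huv
    exact covers_oddShapeAt_of_skipNext (by lia) (toResidue_ne_neg_one hn u)
      (toResidue_ne_neg_one hn v) ((next_iff_skipNext_toResidue hn).1 huv)

end OddCycle

theorem natCeil_half (n : ℕ) : ⌈(n : ℚ) / 2⌉₊ = (n + 1) / 2 := by
  refine eq_of_forall_ge_iff fun c => ?_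
  rw [Nat.ceil_le, div_le_iff₀ two_pos, Nat.div_le_iff_le_mul two_pos]
  norm_cast
  lia

theorem exists_isUniform_six_edgeIntersection_eq_cycle {n : ℕ} (hn : 18 ≤ n)
    (h : Even n ∨ 25 ≤ n) : ∃ H : Hypergraph (Fin n), H.IsUniform 6 ∧
      H.edgeIntersection = cycle n ∧ H.edgeSet.ncard = ⌈(n : ℚ) / 2⌉₊ := by
  rw [natCeil_half]
  obtain ⟨m, rfl | rfl⟩ := n.even_or_odd'
  · rw [show (2 * m + 1) / 2 = m by lia]
    exact exists_edgeIntersection_eq_cycle_of_even (by lia)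
  · rw [show (2 * m + 1 + 1) / 2 = m + 1 by lia]
    exact exists_edgeIntersection_eq_cycle_of_odd (by grind) (by lia)

theorem ceil_half_le_ncard_edgeSet {n : ℕ} (hn : 3 ≤ n) {H : Hypergraph (Fin n)}
    (hk : H.IsUniform 6) (hH : H.edgeIntersection = cycle n) :
    ⌈(n : ℚ) / 2⌉₊ ≤ H.edgeSet.ncard := by
  have h := three_mul_card_le_mul_ncard_edgeSet hk hH (nontrivial_neighborSet_cycleGraph hn)
  rw [Fintype.card_fin] at h
  rw [natCeil_half]
  lia

end EdgeIntersection

open EdgeIntersection in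
theorem corollary2p5_general (n : ℕ) (hn : 18 ≤ n) (h : Even n ∨ 25 ≤ n) :
    (∃ H : Hypergraph (Fin n), H.IsUniform 6 ∧
      H.edgeIntersection = Hypergraph.cycle n ∧
      H.edgeSet.ncard = ⌈(n : ℚ) / 2⌉₊) ∧
    Hypergraph.mu 6 n = ⌈(n : ℚ) / 2⌉₊ := by
  have hex := exists_isUniform_six_edgeIntersection_eq_cycle hn h
  refine ⟨hex, le_antisymm (Nat.sInf_le hex) (le_csInf ⟨_, hex⟩ ?_)⟩
  rintro _ ⟨H, hk, hH, rfl⟩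
  exact ceil_half_le_ncard_edgeSet (by lia) hk hH

theorem corollary2p5 (n : ℕ) (hn : 24 ≤ n) :
    (∃ H : Hypergraph (Fin n), H.IsUniform 6 ∧
      H.edgeIntersection = Hypergraph.cycle n ∧
      H.edgeSet.ncard = ⌈(n : ℚ) / 2⌉₊) ∧
    Hypergraph.mu 6 n = ⌈(n : ℚ) / 2⌉₊ :=
  corollary2p5_general n (by lia) (by grind)
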